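/- **Conventions.** Let $0<p\le 1$. A $p$-norm on a real vector space $Z$ is a map $\|\cdot\|:Z\to[0,\infty)$ with $\|x\|>0$ for $x\ne 0$, $\|\alpha x\|=|\alpha|\,\|x\|$ for every scalar $\alpha$, and $\|x+y\|^p\le\|x\|^p+\|y\|^p$ for all $x,y\in Z$; $(Z,\|\cdot\|)$ is a $p$-Banach space if $Z$ is complete for the metric $d(x,y)=\|x-y\|^p$. For a map $f$ from a metric space $(X,\rho)$ into $Z$, $\operatorname{Lip} f$ is the least $L\ge 0$ with $\|f(x)-f(y)\|\le L\,\rho(x,y)$ for all $x,y\in X$, and $f$ is Lipschitz if such an $L<\infty$ exists. For metric spaces $\mathcal N\subseteq\mathcal M$, the $p$-trace $\mathfrak t_p(\mathcal N,\mathcal M)$ is the infimum of all $C\in(0,\infty]$ such that for every $p$-Banach space $Z$, every Lipschitz map $f:\mathcal N\to Z$ has a Lipschitz extension $\tilde f:\mathcal M\to Z$ with $\operatorname{Lip}\tilde f\le C\operatorname{Lip} f$. The absolute $p$-extendability constant of $\mathcal N$ is $\mathfrak{ae}_p(\mathcal N)=\sup\{\mathfrak t_p(\mathcal N,\mathcal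 M):\mathcal M\supseteq\mathcal N\text{ a metric space}\}\in[0,\infty]$. A metric space $\mathcal N$ is doubling with doubling constant $\lambda_{\mathcal N}\in\mathbb N$ if every closed ball of radius $2r>0$ in $\mathcal N$ can be covered by $\lambda_{\mathcal N}$ closed balls of radius $r$ in $\mathcal N$. **Corollary 3.4.** For every $p$ with $0<p\le 1$ there is a constant $C(p)\ge 0$, depending only on $p$, such that for every metric space $\mathcal N$ that is doubling with doubling constant $\lambda_{\mathcal N}>1$, $$\mathfrak{ae}_p(\mathcal N)\le C(p)\cdot\lambda_{\mathcal N}^{3/p-3}\cdot\log\lambda_{\mathcal N}.$$ -/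

import Mathlib

open Filter Topology
open scoped NNReal ENNReal

universe u v w

/-- `nrm` is a complete `p`-norm on the real vector space `Z`, i.e. `(Z, nrm)` is a `p`-Banach
space. The quasi-triangle inequality (with constant `2 ^ (1 / p - 1)`) is a consequence of
`rpow_add_le`, and completeness is that of the metric `d x y = nrm (x - y) ^ p`. -/
structure IsPBanachNorm (p : ℝ) {Z : Type w} [AddCommGroup Z] [Module ℝ Z] (nrm : Z → ℝ) :
    Prop where
  nonneg : ∀ x, 0 ≤ nrm x
  pos : ∀ x, x ≠ 0 → 0 < nrm x
  smul : ∀ (a : ℝ) (x : Z), nrm (a • x) = |a| * nrm x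
  rpow_add_le : ∀ x y, nrm (x + y) ^ p ≤ nrm x ^ p + nrm y ^ p
  complete : ∀ z : ℕ → Z,
    (∀ ε > 0, ∃ n₀, ∀ m ≥ n₀, ∀ n ≥ n₀, nrm (z m - z n) ^ p < ε) →
      ∃ l, Tendsto (fun n => nrm (z n - l) ^ p) atTop (𝓝 0)

/-- `L` is a Lipschitz constant of `f : X → Z`, where `Z` carries the (quasi-)norm `nrm`. -/
def IsLipConst {X : Type v} [MetricSpace X] {Z : Type w} [AddCommGroup Z]
    (nrm : Z → ℝ) (f : X → Z) (L : ℝ≥0) : Prop :=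
  ∀ x y, nrm (f x - f y) ≤ L * dist x y

/-- `f : X → Z` is Lipschitz, where `Z` carries the (quasi-)norm `nrm`. -/
def IsLipschitz {X : Type v} [MetricSpace X] {Z : Type w} [AddCommGroup Z]
    (nrm : Z → ℝ) (f : X → Z) : Prop :=
  ∃ L, IsLipConst nrm f L

/-- `Lip f`, the best Lipschitz constant of `f` (it is `∞` if `f` is not Lipschitz). -/
noncomputable def lip {X : Type v} [MetricSpace X] {Z : Type w} [AddCommGroup Z]
    (nrm : Z → ℝ) (f : X → Z) : ℝ≥0∞ :=
  ⨅ (L : ℝ≥0) (_ : IsLipConst nrm f L), (L : ℝ≥0∞)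

/-- Every Lipschitz map from the subset `S` of `M` into a `p`-Banach space extends to a Lipschitz
map on `M`, with the Lipschitz constant multiplied by at most `C`. -/
def ExtendsWith (p : ℝ) {M : Type v} [MetricSpace M] (S : Set M) (C : ℝ≥0∞) : Prop :=
  ∀ (Z : Type w) [AddCommGroup Z] [Module ℝ Z] (nrm : Z → ℝ), IsPBanachNorm p nrm →
    ∀ f : S → Z, IsLipschitz nrm f →
      ∃ F : M → Z, (∀ x : S, F x = f x) ∧ IsLipschitz nrm F ∧ lip nrm F ≤ C * lip nrm f

/-- The `p`-trace of the subset `S` in the metric space `M`; it is `∞` if no `C` works. -/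
noncomputable def pTrace (p : ℝ) {M : Type v} [MetricSpace M] (S : Set M) : ℝ≥0∞ :=
  sInf {C : ℝ≥0∞ | 0 < C ∧ ExtendsWith.{v, w} p S C}

/-- The absolute `p`-extendability constant of `N`: the supremum of the `p`-traces of `N` in all
metric spaces `M` that contain `N` (isometrically, by way of `i`). The universes of `M` and of the
target spaces are at least that of `N`, and otherwise arbitrary. -/
noncomputable def absExt (p : ℝ) (N : Type u) [MetricSpace N] : ℝ≥0∞ :=
  ⨆ (M : Type (max u v)) (_ : MetricSpace M) (i : N → M) (_ : Isometry i),
    pTrace.{max u v, max u w} p (Set.range i)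

/-- `N` is doubling with doubling constant `k`: every closed ball of radius `2 * r > 0` is covered
by (at most) `k` closed balls of radius `r`, with centres in `N`. -/
def IsDoublingWith (N : Type u) [MetricSpace N] (k : ℕ) : Prop :=
  ∀ (x : N) (r : ℝ), 0 < r → ∃ t : Finset N, t.card ≤ k ∧
    Metric.closedBall x (2 * r) ⊆ ⋃ y ∈ t, Metric.closedBall y r

/-! The extension is a Whitney average. Off the closure of the subspace, at distance `δ x` from it,
`F x` is a convex combination of values of the map at net points within a multiple of `δ x`. Only
two dyadic scales are active at `x`, and doubling allows at most `k ^ 2` net points in each, hence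
at most `k ^ 3` terms.

Two losses occur. A sum of `m` vectors in a `p`-normed space costs `m ^ (1 / p - 1)`
(`sum_smul_le`), which gives `k ^ (3 / p - 3)`. The weights must also vary slowly in `ℓ₁`:
normalising the bumps themselves could cost a factor of order `k ^ 3`, so their `(r + 1)`-st powers
are normalised. Once `2 ^ r` exceeds the number of terms, small bumps contribute negligibly and the
`ℓ₁` variation is only linear in `r` (`sum_abs_pow_div_sum_sub_le`). Taking `r` of order `log k`
gives the logarithm. -/

/-! ### Calculus in `p`-Banach spaces and extension to the closure. -/

namespace IsPBanachNorm

variable {p : ℝ} {Z : Type w} [AddCommGroup Z] [Module ℝ Z] {nrm : Z → ℝ}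

theorem map_zero (h : IsPBanachNorm p nrm) : nrm 0 = 0 := by
  simpa using h.smul 0 0

theorem map_neg (h : IsPBanachNorm p nrm) (x : Z) : nrm (-x) = nrm x := by
  simpa using h.smul (-1) x

theorem map_sub_rev (h : IsPBanachNorm p nrm) (x y : Z) : nrm (x - y) = nrm (y - x) := by
  rw [← h.map_neg, neg_sub]

theorem rpow_sum_le (h : IsPBanachNorm p nrm) (hp : 0 < p) {ι : Type*} (s : Finset ι)
    (v : ι → Z) : nrm (∑ i ∈ s, v i) ^ p ≤ ∑ i ∈ s, nrm (v i) ^ p := by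
  classical
  induction s using Finset.induction_on with
  | empty => simp [h.map_zero, Real.zero_rpow hp.ne']
  | insert a s ha ih =>
    rw [Finset.sum_insert ha, Finset.sum_insert ha]
    exact (h.rpow_add_le _ _).trans (by gcongr)

/-- A linear combination of at most `m` vectors of norm at most `D`. -/
theorem sum_smul_le (h : IsPBanachNorm p nrm) (hp : 0 < p) (hp1 : p ≤ 1) {ι : Type*}
    {s : Finset ι} {m : ℝ} (hm : (s.card : ℝ) ≤ m) (c : ι → ℝ) (v : ι → Z) {D : ℝ}
    (hv : ∀ i ∈ s, nrm (v i) ≤ D) :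
    nrm (∑ i ∈ s, c i • v i) ≤ m ^ (1 / p - 1) * (D * ∑ i ∈ s, |c i|) := by
  rcases s.eq_empty_or_nonempty with rfl | ⟨i₀, hi₀⟩
  · simp [h.map_zero]
  have hD : 0 ≤ D := (h.nonneg _).trans (hv i₀ hi₀)
  have hp1' : 1 ≤ 1 / p := by rw [le_div_iff₀ hp]; linarith
  have key : nrm (∑ i ∈ s, c i • v i) ^ p ≤ ∑ i ∈ s, (|c i| * D) ^ p := by
    refine (h.rpow_sum_le hp s _).trans (Finset.sum_le_sum fun i hi => ?_)
    rw [h.smul]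
    exact Real.rpow_le_rpow (mul_nonneg (abs_nonneg _) (h.nonneg _))
      (mul_le_mul_of_nonneg_left (hv i hi) (abs_nonneg _)) hp.le
  have e1 : ∀ a : ℝ, 0 ≤ a → (a ^ p) ^ (1 / p) = a := fun a ha => by
    rw [← Real.rpow_mul ha, mul_one_div_cancel hp.ne', Real.rpow_one]
  calc nrm (∑ i ∈ s, c i • v i) = (nrm (∑ i ∈ s, c i • v i) ^ p) ^ (1 / p) :=
        (e1 _ (h.nonneg _)).symm
    _ ≤ (∑ i ∈ s, (|c i| * D) ^ p) ^ (1 / p) :=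
        Real.rpow_le_rpow (Real.rpow_nonneg (h.nonneg _) _) key (by positivity)
    -- Convexity of `t ↦ t ^ (1 / p)`; this is where the number of terms enters.
    _ ≤ (s.card : ℝ) ^ (1 / p - 1) * ∑ i ∈ s, ((|c i| * D) ^ p) ^ (1 / p) :=
        Real.rpow_sum_le_const_mul_sum_rpow_of_nonneg s hp1'
          fun i _ => Real.rpow_nonneg (mul_nonneg (abs_nonneg _) hD) _
    _ = (s.card : ℝ) ^ (1 / p - 1) * (D * ∑ i ∈ s, |c i|) := by
        congr 1
        rw [Finset.mul_sum]
        refine Finset.sum_congr rfl fun i _ => ?_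
        rw [e1 _ (mul_nonneg (abs_nonneg _) hD), mul_comm]
    _ ≤ m ^ (1 / p - 1) * (D * ∑ i ∈ s, |c i|) := by
        have : 0 ≤ D * ∑ i ∈ s, |c i| :=
          mul_nonneg hD (Finset.sum_nonneg fun i _ => abs_nonneg _)
        exact mul_le_mul_of_nonneg_right
          (Real.rpow_le_rpow (Nat.cast_nonneg _) hm (by linarith)) this

theorem sub_le (h : IsPBanachNorm p nrm) (hp : 0 < p) {x y : Z} {B : ℝ}
    (hx : nrm x ≤ B) (hy : nrm y ≤ B) : nrm (x - y) ≤ 2 ^ (1 / p) * B := by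
  have hB : 0 ≤ B := (h.nonneg _).trans hx
  have h1 : nrm (x - y) ^ p ≤ 2 * B ^ p := by
    have := h.rpow_add_le x (-y)
    rw [← sub_eq_add_neg, h.map_neg] at this
    have a := Real.rpow_le_rpow (h.nonneg _) hx hp.le
    have b := Real.rpow_le_rpow (h.nonneg _) hy hp.le
    linarith
  have h2 : (2 ^ (1 / p) * B) ^ p = 2 * B ^ p := by
    rw [Real.mul_rpow (by positivity) hB, ← Real.rpow_mul (by norm_num),
      one_div_mul_cancel hp.ne', Real.rpow_one]
  rw [← h2] at h1
  exact (Real.rpow_le_rpow_iff (h.nonneg _) (by positivity) hp).1 h1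

theorem rpow_sub_le (h : IsPBanachNorm p nrm) (a b c : Z) :
    nrm (a - c) ^ p ≤ nrm (a - b) ^ p + nrm (b - c) ^ p := by
  simpa using h.rpow_add_le (a - b) (b - c)

theorem eq_of_sub_le_zero (h : IsPBanachNorm p nrm) {x y : Z} (hxy : nrm (x - y) ≤ 0) :
    x = y := by
  by_contra hne
  exact absurd (h.pos _ (sub_ne_zero.2 hne)) (not_lt.2 hxy)

/-- If `f ∘ a → l` and `f ∘ b → l'` along sequences `i ∘ a → x` and `i ∘ b → y`, then the
Lipschitz bound of `f` passes to the limit. -/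
theorem sub_le_of_tendsto (h : IsPBanachNorm p nrm) (hp : 0 < p) {M : Type*} [MetricSpace M]
    {N : Type*} {i : N → M} {f : N → Z} {L : ℝ≥0}
    (hf : ∀ s t, nrm (f s - f t) ≤ L * dist (i s) (i t)) {x y : M} {l l' : Z} {a b : ℕ → N}
    (ha : Tendsto (fun n => i (a n)) atTop (𝓝 x)) (hb : Tendsto (fun n => i (b n)) atTop (𝓝 y))
    (hl : Tendsto (fun n => nrm (f (a n) - l) ^ p) atTop (𝓝 0))
    (hl' : Tendsto (fun n => nrm (f (b n) - l') ^ p) atTop (𝓝 0)) :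
    nrm (l - l') ≤ L * dist x y := by
  have h1 : Tendsto (fun n => nrm (f (a n) - l) ^ p + (L * dist (i (a n)) (i (b n))) ^ p
      + nrm (f (b n) - l') ^ p) atTop (𝓝 (0 + (L * dist x y) ^ p + 0)) :=
    (hl.add (((ha.dist hb).const_mul _).rpow_const (Or.inr hp.le))).add hl'
  rw [zero_add, add_zero] at h1
  have h2 : nrm (l - l') ^ p ≤ (L * dist x y) ^ p := by
    refine ge_of_tendsto' h1 fun n => ?_
    have e1 := h.rpow_sub_le l (f (a n)) l'
    have e2 := h.rpow_sub_le (f (a n)) (f (b n)) l'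
    have e3 := Real.rpow_le_rpow (h.nonneg _) (hf (a n) (b n)) hp.le
    rw [h.map_sub_rev l (f (a n))] at e1
    linarith
  exact (Real.rpow_le_rpow_iff (h.nonneg _) (by positivity) hp).1 h2

/-- A Lipschitz map extends to the closure with the same Lipschitz constant. -/
theorem exists_extend_closure (h : IsPBanachNorm p nrm) (hp : 0 < p) {M : Type*} [MetricSpace M]
    {N : Type*} {i : N → M} {f : N → Z} {L : ℝ≥0}
    (hf : ∀ s t, nrm (f s - f t) ≤ L * dist (i s) (i t)) :
    ∃ g : M → Z, (∀ s, g (i s) = f s) ∧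
      ∀ x ∈ closure (Set.range i), ∀ y ∈ closure (Set.range i),
        nrm (g x - g y) ≤ L * dist x y := by
  have key : ∀ x, ∃ l : Z, x ∈ closure (Set.range i) →
      ∃ a : ℕ → N, Tendsto (fun n => i (a n)) atTop (𝓝 x) ∧
        Tendsto (fun n => nrm (f (a n) - l) ^ p) atTop (𝓝 0) := by
    intro x
    by_cases hx : x ∈ closure (Set.range i)
    swap
    · exact ⟨0, fun hx' => absurd hx' hx⟩
    obtain ⟨b, hb, hbx⟩ := mem_closure_iff_seq_limit.1 hx
    choose a ha using hb
    have hax : Tendsto (fun n => i (a n)) atTop (𝓝 x) := by simpa only [ha] using hbx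
    obtain ⟨l, hl⟩ := h.complete (fun n => f (a n)) (by
      intro ε hε
      -- `L + 1` rather than `L`, since `L` may be zero.
      have hε' : 0 < ε ^ (1 / p) / (L + 1) := by positivity
      obtain ⟨n₀, hn₀⟩ := Metric.cauchySeq_iff.1 hax.cauchySeq _ hε'
      refine ⟨n₀, fun m hm n hn => ?_⟩
      have h1 : nrm (f (a m) - f (a n)) < ε ^ (1 / p) := by
        have h3 := (lt_div_iff₀ (by positivity)).1 (hn₀ m hm n hn)
        have h4 := hf (a m) (a n)
        nlinarith [dist_nonneg (x := i (a m)) (y := i (a n))]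
      have h2 := Real.rpow_lt_rpow (h.nonneg _) h1 hp
      rwa [← Real.rpow_mul hε.le, one_div_mul_cancel hp.ne', Real.rpow_one] at h2)
    exact ⟨l, fun _ => ⟨a, hax, hl⟩⟩
  choose g hg using key
  refine ⟨g, fun s => ?_, fun x hx y hy => ?_⟩
  · obtain ⟨a, ha, hl⟩ := hg (i s) (subset_closure ⟨s, rfl⟩)
    refine h.eq_of_sub_le_zero ?_
    -- Against the constant sequence `s` the limiting bound is `L * dist (i s) (i s) = 0`.
    have := h.sub_le_of_tendsto hp hf (b := fun _ => s) (l' := f s) ha tendsto_const_nhds hl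
      (by simp [h.map_zero, Real.zero_rpow hp.ne'])
    simpa using this
  · obtain ⟨a, ha, hl⟩ := hg x hx
    obtain ⟨b, hb, hl'⟩ := hg y hy
    exact h.sub_le_of_tendsto hp hf ha hb hl hl'

end IsPBanachNorm

/-! ### The best Lipschitz constant. -/

/-- The infimum defining `lip` is attained. -/
theorem exists_isLipConst_lip {X : Type v} [MetricSpace X] {Z : Type w} [AddCommGroup Z]
    {nrm : Z → ℝ} {f : X → Z} (hf : IsLipschitz nrm f) :
    ∃ L : ℝ≥0, IsLipConst nrm f L ∧ lip nrm f = L := by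
  set A : Set ℝ≥0 := {L | IsLipConst nrm f L} with hA
  have hne : A.Nonempty := hf
  have e : lip nrm f = ((sInf A : ℝ≥0) : ℝ≥0∞) := by
    rw [ENNReal.coe_sInf hne]; rfl
  refine ⟨sInf A, fun x y => ?_, e⟩
  refine le_of_forall_pos_le_add fun ε hε => ?_
  have hd : 0 < ε / (dist x y + 1) := by positivity
  obtain ⟨L', hL', hlt⟩ := exists_lt_of_csInf_lt hne
    (lt_add_of_pos_right (sInf A) (Real.toNNReal_pos.2 hd))
  have h1 : nrm (f x - f y) ≤ L' * dist x y := hL' x y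
  have h2 : (L' : ℝ) ≤ (sInf A : ℝ≥0) + ε / (dist x y + 1) := by
    have := NNReal.coe_le_coe.2 hlt.le
    rwa [NNReal.coe_add, Real.coe_toNNReal _ hd.le] at this
  have h3 : ε / (dist x y + 1) * dist x y ≤ ε := by
    rw [div_mul_eq_mul_div, div_le_iff₀ (by positivity)]
    nlinarith
  nlinarith [dist_nonneg (x := x) (y := y)]

theorem lip_le_of_isLipConst {X : Type v} [MetricSpace X] {Z : Type w} [AddCommGroup Z]
    {nrm : Z → ℝ} {f : X → Z} {L : ℝ≥0} (hf : IsLipConst nrm f L) : lip nrm f ≤ L :=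
  iInf₂_le L hf

/-! ### Normalised powers in `ℓ₁`. -/

/-- Split at the threshold `t`: a term above it gains a factor `a i / t`, a term below it is at most
`t ^ r`. -/
theorem sum_pow_le_sum_pow_succ_div_add {ι : Type*} (s : Finset ι) {a : ι → ℝ}
    (ha : ∀ i ∈ s, 0 ≤ a i) (r : ℕ) {t : ℝ} (ht : 0 < t) :
    ∑ i ∈ s, a i ^ r ≤ (∑ i ∈ s, a i ^ (r + 1)) / t + s.card * t ^ r := by
  have h : ∀ i ∈ s, a i ^ r ≤ a i ^ (r + 1) / t + t ^ r := by
    intro i hi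
    have h0 := ha i hi
    rcases le_total (a i) t with hle | hle
    · have h1 : a i ^ r ≤ t ^ r := pow_le_pow_left₀ h0 hle r
      have h2 : 0 ≤ a i ^ (r + 1) / t := by positivity
      linarith
    · have h1 : a i ^ r ≤ a i ^ (r + 1) / t := by
        rw [le_div_iff₀ ht, pow_succ]
        exact mul_le_mul_of_nonneg_left hle (by positivity)
      have h2 : 0 ≤ t ^ r := by positivity
      linarith
  refine (Finset.sum_le_sum h).trans_eq ?_
  rw [Finset.sum_add_distrib, Finset.sum_div, Finset.sum_const, nsmul_eq_mul]

/-- Normalised families of nonnegative weights: dividing by the larger total. -/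
theorem sum_abs_div_sum_sub_le {ι : Type*} (s : Finset ι) {a b : ι → ℝ}
    (hb : ∀ i ∈ s, 0 ≤ b i) (hB : 0 < ∑ i ∈ s, b i)
    (hAB : ∑ i ∈ s, b i ≤ ∑ i ∈ s, a i) :
    ∑ i ∈ s, |a i / (∑ j ∈ s, a j) - b i / (∑ j ∈ s, b j)| ≤
      2 * (∑ i ∈ s, |a i - b i|) / ∑ j ∈ s, a j := by
  set A := ∑ j ∈ s, a j with hA
  set B := ∑ j ∈ s, b j with hB'
  have hA0 : 0 < A := hB.trans_le hAB
  -- The last terms sum to `(A - B) / A`, again at most `∑ |a i - b i| / A`; hence the factor 2.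
  have h : ∀ i ∈ s, |a i / A - b i / B| ≤ |a i - b i| / A + b i * (1 / B - 1 / A) := by
    intro i hi
    have h1 : 0 ≤ 1 / B - 1 / A := sub_nonneg.2 (one_div_le_one_div_of_le hB hAB)
    have e : a i / A - b i / B = (a i - b i) / A - b i * (1 / B - 1 / A) := by ring
    rw [e]
    refine (abs_sub _ _).trans_eq ?_
    rw [abs_div, abs_of_pos hA0, abs_of_nonneg (mul_nonneg (hb i hi) h1)]
  refine (Finset.sum_le_sum h).trans ?_
  rw [Finset.sum_add_distrib, ← Finset.sum_div, ← Finset.sum_mul]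
  have h2 : A - B ≤ ∑ i ∈ s, |a i - b i| := by
    rw [hA, hB', ← Finset.sum_sub_distrib]
    exact Finset.sum_le_sum fun i _ => le_abs_self _
  have e : B * (1 / B - 1 / A) = (A - B) / A := by field_simp
  rw [e, ← add_div]
  gcongr
  linarith

/-- The `ℓ₁` distance of two normalised families of `(r + 1)`-st powers, at most `2 ^ r` in
number, is linear in `r`. -/
theorem sum_abs_pow_div_sum_sub_le {ι : Type*} (s : Finset ι) {a b : ι → ℝ} {r : ℕ} {d σ : ℝ}
    (ha : ∀ i ∈ s, 0 ≤ a i) (hb : ∀ i ∈ s, 0 ≤ b i) (hab : ∀ i ∈ s, |a i - b i| ≤ d)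
    (hs : (s.card : ℝ) ≤ 2 ^ r) (hd : 0 ≤ d) (hσ : 0 < σ)
    (hA : σ ^ (r + 1) ≤ ∑ i ∈ s, a i ^ (r + 1)) (hB : σ ^ (r + 1) ≤ ∑ i ∈ s, b i ^ (r + 1)) :
    ∑ i ∈ s, |a i ^ (r + 1) / (∑ j ∈ s, a j ^ (r + 1)) -
      b i ^ (r + 1) / (∑ j ∈ s, b j ^ (r + 1))| ≤ 12 * (r + 1) * d / σ := by
  wlog hAB : ∑ i ∈ s, b i ^ (r + 1) ≤ ∑ i ∈ s, a i ^ (r + 1) generalizing a b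
  · have := this hb ha (fun i hi => by rw [abs_sub_comm]; exact hab i hi) hB hA
      (le_of_not_ge hAB)
    refine le_trans (le_of_eq (Finset.sum_congr rfl fun i _ => abs_sub_comm _ _)) this
  have hσ' : 0 < σ ^ (r + 1) := by positivity
  have hB0 := hσ'.trans_le hB
  have hA0 := hσ'.trans_le hA
  refine (sum_abs_div_sum_sub_le s (fun i hi => pow_nonneg (hb i hi) _) hB0 hAB).trans ?_
  set A := ∑ i ∈ s, a i ^ (r + 1)
  set B := ∑ i ∈ s, b i ^ (r + 1)
  -- With threshold `σ / 2`, the at most `2 ^ r` small terms contribute at most `σ ^ r ≤ A / σ`, so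
  -- their number disappears.
  have bound : ∀ c : ι → ℝ, (∀ i ∈ s, 0 ≤ c i) → ∑ i ∈ s, c i ^ (r + 1) ≤ A →
      ∑ i ∈ s, c i ^ r ≤ 3 / σ * A := by
    intro c hc hcA
    refine (sum_pow_le_sum_pow_succ_div_add s hc r (half_pos hσ)).trans ?_
    have h1 : (∑ i ∈ s, c i ^ (r + 1)) / (σ / 2) ≤ 2 / σ * A := by
      rw [div_le_iff₀ (by positivity)]
      have : 2 / σ * A * (σ / 2) = A := by field_simp
      rwa [this]
    have h2 : s.card * (σ / 2) ^ r ≤ 1 / σ * A := by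
      calc (s.card : ℝ) * (σ / 2) ^ r ≤ 2 ^ r * (σ / 2) ^ r := by gcongr
        _ = 1 / σ * σ ^ (r + 1) := by
            rw [← mul_pow, mul_div_cancel₀ σ two_ne_zero, pow_succ]; field_simp
        _ ≤ 1 / σ * A := by gcongr
    calc _ ≤ 2 / σ * A + 1 / σ * A := add_le_add h1 h2
      _ = 3 / σ * A := by ring
  have h : ∀ i ∈ s, |a i ^ (r + 1) - b i ^ (r + 1)| ≤ d * (r + 1) * (a i ^ r + b i ^ r) := by
    intro i hi
    have h0 := ha i hi
    have h1 := hb i hi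
    have h2 := abs_pow_sub_pow_le (a i) (b i) (r + 1)
    rw [abs_of_nonneg h0, abs_of_nonneg h1, Nat.add_sub_cancel] at h2
    refine h2.trans ?_
    have h3 : max (a i) (b i) ^ r ≤ a i ^ r + b i ^ r := by
      rcases max_cases (a i) (b i) with ⟨e, _⟩ | ⟨e, _⟩ <;> rw [e]
      · linarith [pow_nonneg h1 r]
      · linarith [pow_nonneg h0 r]
    push_cast
    gcongr
    exact hab i hi
  have h4 : ∑ i ∈ s, |a i ^ (r + 1) - b i ^ (r + 1)| ≤ d * (r + 1) * (6 / σ * A) := by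
    refine (Finset.sum_le_sum h).trans ?_
    rw [← Finset.mul_sum, Finset.sum_add_distrib]
    have := bound a ha le_rfl
    have := bound b hb hAB
    gcongr
    calc _ ≤ 3 / σ * A + 3 / σ * A := add_le_add ‹_› ‹_›
      _ = _ := by ring
  rw [div_le_iff₀ hA0]
  calc _ ≤ 2 * (d * (r + 1) * (6 / σ * A)) := by gcongr
    _ = _ := by ring

/-! ### Separated nets and counting in doubling spaces. -/

/-- A maximal `c`-separated subset. -/
theorem exists_separated_net (N : Type*) [MetricSpace N] {c : ℝ} (hc : 0 < c) :
    ∃ A : Set N, (∀ x ∈ A, ∀ y ∈ A, x ≠ y → c < dist x y) ∧ ∀ x, ∃ y ∈ A, dist x y ≤ c := by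
  obtain ⟨A, hA⟩ := zorn_subset {A : Set N | ∀ x ∈ A, ∀ y ∈ A, x ≠ y → c < dist x y} (by
    intro S hS hch
    refine ⟨⋃₀ S, ?_, fun s hs => Set.subset_sUnion_of_mem hs⟩
    rintro x ⟨s, hs, hx⟩ y ⟨t, ht, hy⟩ hxy
    rcases hch.total hs ht with h | h
    · exact hS ht x (h hx) y hy hxy
    · exact hS hs x hx y (h hy) hxy)
  refine ⟨A, hA.prop, fun x => ?_⟩
  by_contra! hx
  have hxA : x ∈ A := by
    refine hA.le_of_ge (y := insert x A) ?_ (Set.subset_insert _ _) (Set.mem_insert _ _)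
    rintro y (rfl | hy) z (rfl | hz) hyz
    · exact absurd rfl hyz
    · exact hx z hz
    · rw [dist_comm]; exact hx y hy
    · exact hA.prop y hy z hz hyz
  have := hx x hxA
  rw [dist_self] at this
  linarith

namespace IsDoublingWith

variable {N : Type*} [MetricSpace N] {k : ℕ}

theorem exists_cover_sq (h : IsDoublingWith N k) (x : N) {r : ℝ} (hr : 0 < r) :
    ∃ t : Finset N, t.card ≤ k ^ 2 ∧
      ∀ y, dist y x ≤ 4 * r → ∃ z ∈ t, dist y z ≤ r := by
  classical
  obtain ⟨t, htc, ht⟩ := h x (2 * r) (by positivity)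
  choose s hsc hs using fun z => h z r hr
  refine ⟨t.biUnion s, ?_, fun y hy => ?_⟩
  · calc (t.biUnion s).card ≤ t.card * k := Finset.card_biUnion_le_card_mul _ _ _ fun z _ => hsc z
      _ ≤ k * k := by gcongr
      _ = k ^ 2 := by ring
  · have h1 : y ∈ Metric.closedBall x (2 * (2 * r)) := by
      rw [Metric.mem_closedBall]; linarith
    obtain ⟨z, hz, hyz⟩ := Set.mem_iUnion₂.1 (ht h1)
    obtain ⟨w, hw, hyw⟩ := Set.mem_iUnion₂.1 (hs z hyz)
    exact ⟨w, Finset.mem_biUnion.2 ⟨z, hz, hw⟩, hyw⟩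

/-- A separated set in a ball is finite, with a bound on its cardinality. -/
theorem finite_of_separated (h : IsDoublingWith N k) (x : N) {r : ℝ} (hr : 0 < r) {A : Set N}
    (hA : ∀ y ∈ A, ∀ z ∈ A, y ≠ z → 2 * r < dist y z) (hx : ∀ y ∈ A, dist y x ≤ 4 * r) :
    ∃ t : Finset N, t.card ≤ k ^ 2 ∧ ∀ y, y ∈ t ↔ y ∈ A := by
  classical
  obtain ⟨t, htc, ht⟩ := h.exists_cover_sq x hr
  choose! φ hφt hφ using fun y (hy : y ∈ A) => ht y (hx y hy)
  have hinj : Set.InjOn φ A := by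
    intro y hy z hz hyz
    by_contra hne
    have h1 := hA y hy z hz hne
    have h2 := hφ y hy
    have h3 := hφ z hz
    rw [← hyz] at h3
    linarith [dist_triangle_right y z (φ y)]
  have hfin : A.Finite := Set.Finite.of_finite_image
    (t.finite_toSet.subset (Set.image_subset_iff.2 hφt)) hinj
  refine ⟨hfin.toFinset, ?_, fun y => hfin.mem_toFinset⟩
  refine (Finset.card_le_card_of_injOn φ (fun y hy => hφt y (hfin.mem_toFinset.1 hy))
    fun y hy z hz => hinj (hfin.mem_toFinset.1 hy) (hfin.mem_toFinset.1 hz)).trans htc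

end IsDoublingWith

/-! ### Whitney bumps. -/

/-- The profile of the bump functions: `P` is the scale, `t` the distance to the subspace and `s`
the distance to the centre. -/
noncomputable def bumpProfile (P t s : ℝ) : ℝ :=
  max 0 (min (15 * P - s) (min (t - P / 2) (2 * P - t)))

theorem bumpProfile_nonneg (P t s : ℝ) : 0 ≤ bumpProfile P t s := le_max_left _ _

theorem abs_bumpProfile_sub_le (P : ℝ) {t t' s s' d : ℝ} (ht : |t - t'| ≤ d) (hs : |s - s'| ≤ d) :
    |bumpProfile P t s - bumpProfile P t' s'| ≤ d := by
  have hd : 0 ≤ d := (abs_nonneg _).trans ht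
  unfold bumpProfile
  refine (abs_max_sub_max_le_max _ _ _ _).trans (max_le (by simpa using hd) ?_)
  refine (abs_min_sub_min_le_max _ _ _ _).trans (max_le ?_ ?_)
  · rw [show 15 * P - s - (15 * P - s') = -(s - s') by ring, abs_neg]; exact hs
  refine (abs_min_sub_min_le_max _ _ _ _).trans (max_le ?_ ?_)
  · rw [show t - P / 2 - (t' - P / 2) = t - t' by ring]; exact ht
  · rw [show 2 * P - t - (2 * P - t') = -(t - t') by ring, abs_neg]; exact ht

theorem lt_of_bumpProfile_ne_zero {P t s : ℝ} (h : bumpProfile P t s ≠ 0) :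
    s < 15 * P ∧ P / 2 < t ∧ t < 2 * P := by
  have h1 : 0 < bumpProfile P t s := lt_of_le_of_ne (bumpProfile_nonneg _ _ _) h.symm
  unfold bumpProfile at h1
  simp only [lt_max_iff, lt_self_iff_false, false_or, lt_min_iff, sub_pos] at h1
  exact h1

/-- Bump functions of Whitney type on the complement of an isometric copy of a doubling space. -/
theorem exists_whitney_bumps {N : Type*} [MetricSpace N] [Nonempty N] {k : ℕ} (hk : 1 < k)
    (h : IsDoublingWith N k) {M : Type*} [MetricSpace M] {i : N → M} (hi : Isometry i) :
    ∃ (ψ : ℤ × N → M → ℝ) (act : M → Finset (ℤ × N)),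
      (∀ a x, 0 ≤ ψ a x) ∧ (∀ a x y, |ψ a x - ψ a y| ≤ dist x y) ∧
      ∀ x, 0 < Metric.infDist x (Set.range i) →
        (∀ a, a ∉ act x → ψ a x = 0) ∧ (act x).card ≤ k ^ 3 ∧
        (∃ a ∈ act x, Metric.infDist x (Set.range i) / 4 ≤ ψ a x) ∧
        ∀ a ∈ act x, dist (i a.2) x ≤ 30 * Metric.infDist x (Set.range i) := by
  classical
  have hP : ∀ j : ℤ, (0 : ℝ) < 2 ^ j := fun j => by positivity
  choose A hAsep hAnet using fun j : ℤ => exists_separated_net N (c := 10 * 2 ^ j)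
    (mul_pos (by norm_num) (hP j))
  -- The value zero off the net lets all scales share the index type `ℤ × N`.
  let ψ : ℤ × N → M → ℝ := fun a x => if a.2 ∈ A a.1 then
    bumpProfile (2 ^ a.1) (Metric.infDist x (Set.range i)) (dist x (i a.2)) else 0
  have key : ∀ x, ∃ T : Finset (ℤ × N), 0 < Metric.infDist x (Set.range i) →
        (∀ a, a ∉ T → ψ a x = 0) ∧ T.card ≤ k ^ 3 ∧
        (∃ a ∈ T, Metric.infDist x (Set.range i) / 4 ≤ ψ a x) ∧
        ∀ a ∈ T, dist (i a.2) x ≤ 30 * Metric.infDist x (Set.range i) := by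
    intro x
    by_cases hδ : 0 < Metric.infDist x (Set.range i)
    swap
    · exact ⟨∅, fun h' => absurd h' hδ⟩
    obtain ⟨_, ⟨n, rfl⟩, hn⟩ := (Metric.infDist_lt_iff (Set.range_nonempty i)).1
      (show Metric.infDist x (Set.range i) < 2 * Metric.infDist x (Set.range i) by linarith)
    obtain ⟨J, hJ1, hJ2⟩ := exists_mem_Ico_zpow hδ (one_lt_two (α := ℝ))
    have hJs : (2 : ℝ) ^ (J + 1) = 2 * 2 ^ J := by rw [zpow_add_one₀ two_ne_zero]; ring
    rw [hJs] at hJ2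
    set δ := Metric.infDist x (Set.range i) with hδdef
    have hJpos := hP J
    have hfin : ∀ j, ∃ t : Finset N, J ≤ j →
        t.card ≤ k ^ 2 ∧ ∀ z, z ∈ t ↔ z ∈ {z | z ∈ A j ∧ dist x (i z) < 15 * 2 ^ j} := by
      intro j
      by_cases hj : J ≤ j
      swap
      · exact ⟨∅, fun h' => absurd h' hj⟩
      have hJj : (2 : ℝ) ^ J ≤ 2 ^ j := zpow_le_zpow_right₀ one_le_two hj
      -- The net is `10 * 2 ^ j`-separated, and active centres lie within `(15 + 4) * 2 ^ j` of `n`,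
      -- since `2 * δ < 4 * 2 ^ J`.
      obtain ⟨t, ht⟩ := h.finite_of_separated n (r := 5 * 2 ^ j) (mul_pos (by norm_num) (hP j))
        (A := {z | z ∈ A j ∧ dist x (i z) < 15 * 2 ^ j})
        (fun y hy z hz hyz => by
          have := hAsep j y hy.1 z hz.1 hyz
          linarith)
        (fun y hy => by
          rw [← hi.dist_eq]
          have := dist_triangle_left (i y) (i n) x
          have h2 := hy.2
          linarith)
      exact ⟨t, fun _ => ht⟩
    choose t ht using hfin
    have hmem : ∀ j z, (j = J ∨ j = J + 1) → z ∈ A j → dist x (i z) < 15 * 2 ^ j →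
        (j, z) ∈ ({J, J + 1} : Finset ℤ).biUnion fun j => (t j).image fun z => (j, z) := by
      intro j z hj hz hd
      simp only [Finset.mem_biUnion, Finset.mem_image]
      refine ⟨j, by simpa using hj, z, ?_, rfl⟩
      exact ((ht j (by omega)).2 z).2 ⟨hz, hd⟩
    refine ⟨({J, J + 1} : Finset ℤ).biUnion fun j => (t j).image fun z => (j, z), fun _ => ?_⟩
    refine ⟨?_, ?_, ?_, ?_⟩
    · rintro ⟨j, z⟩ ha
      by_contra hne
      have hz : z ∈ A j := by
        by_contra hz
        exact hne (if_neg hz)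
      have hne' : bumpProfile (2 ^ j) δ (dist x (i z)) ≠ 0 := by
        have e : ψ (j, z) x = bumpProfile (2 ^ j) δ (dist x (i z)) := if_pos hz
        rwa [e] at hne
      obtain ⟨h1, h2, h3⟩ := lt_of_bumpProfile_ne_zero hne'
      refine ha (hmem j z ?_ hz h1)
      -- From `2 ^ j / 2 < δ < 2 * 2 ^ j` and `2 ^ J ≤ δ < 2 ^ (J + 1)`, only `j = J` and `j = J +
      -- 1` survive.
      have h4 : (2 : ℝ) ^ j < 2 ^ (J + 2) := by
        rw [zpow_add₀ two_ne_zero]; norm_num; linarith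
      have h5 : (2 : ℝ) ^ J < 2 ^ (j + 1) := by
        rw [zpow_add_one₀ two_ne_zero]; linarith
      have h4' := (zpow_lt_zpow_iff_right₀ (one_lt_two (α := ℝ))).1 h4
      have h5' := (zpow_lt_zpow_iff_right₀ (one_lt_two (α := ℝ))).1 h5
      omega
    · calc _ ≤ ({J, J + 1} : Finset ℤ).card * k ^ 2 := by
            refine Finset.card_biUnion_le_card_mul _ _ _ fun j hj => ?_
            refine Finset.card_image_le.trans (ht j ?_).1
            simp only [Finset.mem_insert, Finset.mem_singleton] at hj
            omega
        _ ≤ k * k ^ 2 := by gcongr; exact Finset.card_le_two.trans hk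
        _ = k ^ 3 := by ring
    · have hle : ∀ j, (j = J ∨ j = J + 1) → 2 * δ ≤ 3 * 2 ^ j → δ / 4 ≤ δ - 2 ^ j / 2 →
          ∃ a ∈ ({J, J + 1} : Finset ℤ).biUnion fun j => (t j).image fun z => (j, z),
            δ / 4 ≤ ψ a x := by
        intro j hj h1 h2
        obtain ⟨z, hz, hnz⟩ := hAnet j n
        have h3 : dist x (i z) ≤ 13 * 2 ^ j := by
          have := dist_triangle x (i n) (i z)
          rw [hi.dist_eq n z] at this
          linarith
        have hPj := hP j
        refine ⟨(j, z), hmem j z hj hz (by linarith), ?_⟩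
        have e : ψ (j, z) x = bumpProfile (2 ^ j) δ (dist x (i z)) := if_pos hz
        rw [e]
        refine le_max_of_le_right (le_min (by linarith) (le_min h2 (by linarith)))
      -- Each profile vanishes at the ends of its range of `δ`; switching scale at `3 / 2 * 2 ^ J`
      -- keeps one bump above `δ / 4`.
      rcases le_total δ (3 / 2 * 2 ^ J) with hc | hc
      · exact hle J (Or.inl rfl) (by linarith) (by linarith)
      · exact hle (J + 1) (Or.inr rfl) (by rw [hJs]; linarith) (by rw [hJs]; linarith)
    · intro a ha
      simp only [Finset.mem_biUnion, Finset.mem_image] at ha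
      obtain ⟨j, hj, z, hz, rfl⟩ := ha
      simp only [Finset.mem_insert, Finset.mem_singleton] at hj
      have h1 := (((ht j (by omega)).2 z).1 hz).2
      rw [dist_comm]
      rcases hj with rfl | rfl
      · exact h1.le.trans (by linarith)
      · rw [hJs] at h1
        exact h1.le.trans (by linarith)
  choose act hact using key
  refine ⟨ψ, act, fun a x => ?_, fun a x y => ?_, hact⟩
  · by_cases ha : a.2 ∈ A a.1
    · simpa [ψ, ha] using bumpProfile_nonneg _ _ _
    · simp [ψ, ha]
  · by_cases ha : a.2 ∈ A a.1
    · simp only [ψ, ha, if_true]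
      refine abs_bumpProfile_sub_le _ ?_ (abs_dist_sub_le _ _ _)
      simpa [Real.dist_eq] using
        (Metric.lipschitz_infDist_pt (Set.range i)).dist_le_mul x y
    · simp [ψ, ha]

/-! ### The extension. -/

/-- Lipschitz extension from a doubling subspace into a `p`-Banach space. -/
theorem IsPBanachNorm.exists_extension {p : ℝ} (hp : 0 < p) (hp1 : p ≤ 1)
    {Z : Type*} [AddCommGroup Z] [Module ℝ Z] {nrm : Z → ℝ} (hZ : IsPBanachNorm p nrm)
    {N : Type*} [MetricSpace N] {k r : ℕ} (hk : 1 < k) (hr : 2 * k ^ 3 ≤ 2 ^ r)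
    (h : IsDoublingWith N k) {M : Type*} [MetricSpace M] {i : N → M} (hi : Isometry i)
    {f : N → Z} {L : ℝ≥0} (hf : ∀ s t, nrm (f s - f t) ≤ L * dist (i s) (i t)) :
    ∃ F : M → Z, (∀ s, F (i s) = f s) ∧ ∀ x y, nrm (F x - F y) ≤
      2 ^ (1 / p) * (5000 * (r + 1) * ((k : ℝ) ^ 3) ^ (1 / p - 1)) * (L * dist x y) := by
  classical
  rcases isEmpty_or_nonempty N with hN | hN
  · exact ⟨fun _ => 0, fun s => hN.elim s, fun x y => by
      rw [sub_zero, hZ.map_zero]; positivity⟩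
  -- The averaging formula needs `δ > 0`, which fails on the whole closure, so values are needed
  -- there first.
  obtain ⟨g, hgf, hg⟩ := hZ.exists_extend_closure hp hf
  obtain ⟨ψ, act, hψ0, hψL, hact⟩ := exists_whitney_bumps hk h hi
  set δ : M → ℝ := fun x => Metric.infDist x (Set.range i) with hδdef
  set κ : ℝ := ((k : ℝ) ^ 3) ^ (1 / p - 1) with hκ
  have hmem : ∀ s, i s ∈ closure (Set.range i) := fun s => subset_closure ⟨s, rfl⟩
  have hδ0 : ∀ x, 0 ≤ δ x := fun x => Metric.infDist_nonneg
  have hδcl : ∀ x, ¬ 0 < δ x → x ∈ closure (Set.range i) := fun x hx =>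
    (Metric.mem_closure_iff_infDist_zero (Set.range_nonempty i)).2
      (le_antisymm (not_lt.1 hx) (hδ0 x))
  have hδle : ∀ x, ∀ n ∈ closure (Set.range i), δ x ≤ dist x n := fun x n hn => by
    simp only [hδdef]
    rw [← Metric.infDist_closure]
    exact Metric.infDist_le_dist_of_mem hn
  have hδL : ∀ x y, |δ x - δ y| ≤ dist x y := fun x y => by
    simpa [Real.dist_eq] using (Metric.lipschitz_infDist_pt (Set.range i)).dist_le_mul x y
  have hk3 : (1 : ℝ) ≤ (k : ℝ) ^ 3 := one_le_pow₀ (by exact_mod_cast hk.le)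
  have hp' : 0 ≤ 1 / p - 1 := by
    rw [sub_nonneg, le_div_iff₀ hp]; linarith
  have hκ1 : 1 ≤ κ := Real.one_le_rpow hk3 hp'
  set W : M → ℝ := fun x => ∑ a ∈ act x, ψ a x ^ (r + 1) with hW
  have hWσ : ∀ x, 0 < δ x → (δ x / 4) ^ (r + 1) ≤ W x := by
    intro x hx
    obtain ⟨a, ha, hax⟩ := (hact x hx).2.2.1
    exact (pow_le_pow_left₀ (by positivity) hax _).trans
      (Finset.single_le_sum (f := fun a => ψ a x ^ (r + 1))
        (fun b _ => pow_nonneg (hψ0 b x) _) ha)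
  have hWpos : ∀ x, 0 < δ x → 0 < W x := fun x hx =>
    lt_of_lt_of_le (by positivity) (hWσ x hx)
  set φ : ℤ × N → M → ℝ := fun a x => ψ a x ^ (r + 1) / W x with hφ
  have hφ0 : ∀ a x, 0 ≤ φ a x := fun a x =>
    div_nonneg (pow_nonneg (hψ0 _ _) _) (Finset.sum_nonneg fun b _ => pow_nonneg (hψ0 _ _) _)
  have hφ1 : ∀ x, 0 < δ x → ∑ a ∈ act x, φ a x = 1 := fun x hx => by
    simp only [hφ]
    rw [← Finset.sum_div, div_self (hWpos x hx).ne']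
  set F : M → Z := fun x => if 0 < δ x then ∑ a ∈ act x, φ a x • g (i a.2) else g x with hF
  -- The weights sum to one, so any constant can be subtracted inside; enlarging `act x` lets two
  -- points share an index set.
  have hFsub : ∀ x, 0 < δ x → ∀ T, act x ⊆ T → ∀ c : Z,
      F x - c = ∑ a ∈ T, φ a x • (g (i a.2) - c) := by
    intro x hx T hT c
    have h0 : ∀ a ∈ T, a ∉ act x → φ a x • (g (i a.2) - c) = 0 := fun a _ ha => by
      simp [hφ, (hact x hx).1 a ha]
    rw [← Finset.sum_subset hT h0]
    simp only [hF, if_pos hx, smul_sub, Finset.sum_sub_distrib]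
    rw [← Finset.sum_smul, hφ1 x hx, one_smul]
  have hFg : ∀ x ∈ closure (Set.range i), F x = g x := fun x hx =>
    if_neg (by
      rw [not_lt]; exact ((Metric.mem_closure_iff_infDist_zero (Set.range_nonempty i)).1 hx).le)
  -- comparison with the values on the closure
  have hfar : ∀ x, ∀ n ∈ closure (Set.range i), nrm (F x - g n) ≤ κ * (31 * L * dist x n) := by
    intro x n hn
    by_cases hx : 0 < δ x
    · rw [hFsub x hx _ subset_rfl]
      obtain ⟨-, hc, -, hd⟩ := hact x hx
      refine (hZ.sum_smul_le hp hp1 (m := (k : ℝ) ^ 3) (by exact_mod_cast hc) _ _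
        (D := 31 * L * dist x n) fun a ha => ?_).trans_eq ?_
      · refine (hg _ (hmem _) _ hn).trans ?_
        have h1 := hd a ha
        have h2 := dist_triangle (i a.2) x n
        have h3 := hδle x n hn
        rw [mul_comm 31 (L : ℝ), mul_assoc]
        gcongr
        linarith
      · rw [Finset.sum_congr rfl fun a _ => abs_of_nonneg (hφ0 a x), hφ1 x hx, mul_one]
    · rw [hFg x (hδcl x hx)]
      refine (hg _ (hδcl x hx) _ hn).trans ?_
      have h1 : 0 ≤ (L : ℝ) * dist x n := by positivity
      nlinarith
  refine ⟨F, fun s => by rw [hFg _ (hmem s), hgf], fun x y => ?_⟩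
  have hnear : ∃ n ∈ closure (Set.range i), dist x n ≤ 2 * δ x := by
    by_cases hx : 0 < δ x
    · obtain ⟨n, hn, hd⟩ := (Metric.infDist_lt_iff (Set.range_nonempty i)).1
        (show Metric.infDist x (Set.range i) < 2 * δ x by simp only [hδdef] at hx ⊢; linarith)
      exact ⟨n, subset_closure hn, hd.le⟩
    · exact ⟨x, hδcl x hx, by rw [dist_self]; linarith [hδ0 x]⟩
  obtain ⟨n, hn, hxn⟩ := hnear
  -- Close pairs have comparable `δ` and are compared weight by weight; for the others, going
  -- through `n` suffices.
  rcases lt_or_ge (dist x y) (δ x / 2) with hxy | hxy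
  · have hx : 0 < δ x := by linarith [dist_nonneg (x := x) (y := y)]
    have hδxy := abs_le.1 (hδL x y)
    have hy' : δ x / 2 < δ y := by linarith
    have hy : 0 < δ y := by linarith
    obtain ⟨-, hxc, -, hxd⟩ := hact x hx
    obtain ⟨-, hyc, -, hyd⟩ := hact y hy
    set T := act x ∪ act y with hT
    have hTc : T.card ≤ 2 * k ^ 3 := (Finset.card_union_le _ _).trans (by omega)
    have hWT : ∀ z, 0 < δ z → act z ⊆ T → W z = ∑ a ∈ T, ψ a z ^ (r + 1) := fun z hz hzT =>
      Finset.sum_subset hzT fun a _ ha => by simp [(hact z hz).1 a ha]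
    have hWx := hWT x hx Finset.subset_union_left
    have hWy := hWT y hy Finset.subset_union_right
    -- `σ = δ x / 8` lies below both `δ x / 4` and `δ y / 4`, because `δ y > δ x / 2`.
    have hsum : ∑ a ∈ T, |φ a x - φ a y| ≤ 12 * (r + 1) * dist x y / (δ x / 8) := by
      simp only [hφ]
      rw [hWx, hWy]
      refine sum_abs_pow_div_sum_sub_le T (fun a _ => hψ0 a x) (fun a _ => hψ0 a y)
        (fun a _ => hψL a x y) (by exact_mod_cast hTc.trans hr) dist_nonneg (by positivity) ?_ ?_
      · rw [← hWx]
        exact (pow_le_pow_left₀ (by positivity) (by linarith) _).trans (hWσ x hx)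
      · rw [← hWy]
        exact (pow_le_pow_left₀ (by positivity) (by linarith) _).trans (hWσ y hy)
    have e : F x - F y = ∑ a ∈ T, (φ a x - φ a y) • (g (i a.2) - g n) := by
      rw [← sub_sub_sub_cancel_right (F x) (F y) (g n),
        hFsub x hx T Finset.subset_union_left, hFsub y hy T Finset.subset_union_right,
        ← Finset.sum_sub_distrib]
      exact Finset.sum_congr rfl fun a _ => (sub_smul _ _ _).symm
    rw [e]
    -- The worst case is a centre active at `y`: `30 * (3 / 2) + 1 / 2 + 2 < 48`.
    have h48 : ∀ a ∈ T, nrm (g (i a.2) - g n) ≤ L * (48 * δ x) := by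
      intro a ha
      refine (hg _ (hmem _) _ hn).trans ?_
      gcongr
      rcases Finset.mem_union.1 ha with ha | ha
      · linarith [hxd a ha, dist_triangle (i a.2) x n]
      · have h1 := hyd a ha
        have h2 := dist_triangle4 (i a.2) y x n
        rw [dist_comm y x] at h2
        change dist (i a.2) y ≤ 30 * δ y at h1
        linarith
    refine (hZ.sum_smul_le hp hp1 (m := 2 * (k : ℝ) ^ 3) (by exact_mod_cast hTc) _ _ h48).trans ?_
    have hm : (2 * (k : ℝ) ^ 3) ^ (1 / p - 1) ≤ 2 ^ (1 / p) * κ := by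
      rw [Real.mul_rpow (by norm_num) (by positivity)]
      gcongr
      · norm_num
      · linarith
    calc _ ≤ (2 ^ (1 / p) * κ) *
          (L * (48 * δ x) * (12 * (r + 1) * dist x y / (δ x / 8))) := by gcongr
      _ = 2 ^ (1 / p) * (4608 * (r + 1) * κ) * (L * dist x y) := by
          field_simp
          ring
      _ ≤ _ := by gcongr; norm_num
  · have h1 := hfar x n hn
    have h2 := hfar y n hn
    have h3 := dist_triangle_left y n x
    rw [← sub_sub_sub_cancel_right (F x) (F y) (g n)]
    -- Here `dist x n ≤ 2 * δ x ≤ 4 * dist x y`, hence `dist y n ≤ 5 * dist x y`.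
    have hb : ∀ z, dist z n ≤ 5 * dist x y → nrm (F z - g n) ≤
        5000 * (r + 1) * κ * (L * dist x y) := by
      intro z hz
      calc _ ≤ κ * (31 * L * dist z n) := hfar z n hn
        _ ≤ κ * (31 * L * (5 * dist x y)) := by gcongr
        _ = 155 * 1 * κ * (L * dist x y) := by ring
        _ ≤ _ := by
          gcongr
          · norm_num
          · linarith [(Nat.cast_nonneg r : (0 : ℝ) ≤ r)]
    refine (hZ.sub_le hp (hb x ?_) (hb y ?_)).trans_eq (by ring)
    · linarith [dist_nonneg (x := x) (y := y)]
    · linarith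

/-! ### Choice of the exponent and conclusion. -/

theorem corollary3p4 (p : ℝ) (hp0 : 0 < p) (hp1 : p ≤ 1) :
    ∃ C : ℝ, 0 ≤ C ∧ ∀ (N : Type u) [MetricSpace N] (k : ℕ), 1 < k → IsDoublingWith N k →
      absExt.{u, v, w} p N ≤ ENNReal.ofReal (C * (k : ℝ) ^ (3 / p - 3) * Real.log k) := by
  have hl2 : 0 < Real.log 2 := Real.log_pos one_lt_two
  refine ⟨2 ^ (1 / p) * (5000 * (8 / Real.log 2)), by positivity, fun N _ k hk hN => ?_⟩
  have hk1 : (1 : ℝ) < k := by exact_mod_cast hk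
  have hlogk : 0 < Real.log k := Real.log_pos hk1
  set C := 2 ^ (1 / p) * (5000 * (8 / Real.log 2)) * (k : ℝ) ^ (3 / p - 3) * Real.log k with hC
  have hC0 : 0 < C := by positivity
  set r := 1 + 3 * Nat.clog 2 k with hrdef
  have hr : 2 * k ^ 3 ≤ 2 ^ r := by
    have h1 : k ≤ 2 ^ Nat.clog 2 k := Nat.le_pow_clog one_lt_two k
    rw [hrdef, pow_add, mul_comm 3, pow_mul, pow_one]
    gcongr
  have hrC : 2 ^ (1 / p) * (5000 * ((r : ℝ) + 1) * ((k : ℝ) ^ 3) ^ (1 / p - 1)) ≤ C := by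
    have e : ((k : ℝ) ^ 3) ^ (1 / p - 1) = (k : ℝ) ^ (3 / p - 3) := by
      rw [← Real.rpow_natCast, ← Real.rpow_mul (by positivity)]
      congr 1
      push_cast
      ring
    -- `r + 1 = 2 + 3 * Nat.clog 2 k` is at most `5 + 3 * log₂ k`, and `log₂ k ≥ 1`.
    have h2 : (r : ℝ) + 1 ≤ 8 / Real.log 2 * Real.log k := by
      have hc : 1 ≤ Nat.clog 2 k := Nat.clog_pos one_lt_two hk
      have h3 : 2 ^ (Nat.clog 2 k - 1) < k := Nat.pow_pred_clog_lt_self one_lt_two hk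
      have h4 : ((Nat.clog 2 k - 1 : ℕ) : ℝ) * Real.log 2 ≤ Real.log k := by
        rw [← Real.log_pow]
        exact Real.log_le_log (by positivity) (by exact_mod_cast h3.le)
      have h5 : Real.log 2 ≤ Real.log k := Real.log_le_log two_pos (by exact_mod_cast hk)
      rw [Nat.cast_sub hc] at h4
      rw [div_mul_eq_mul_div, le_div_iff₀ hl2, hrdef]
      push_cast at h4 ⊢
      nlinarith
    rw [e, hC]
    calc _ ≤ 2 ^ (1 / p) * (5000 * (8 / Real.log 2 * Real.log k) * (k : ℝ) ^ (3 / p - 3)) := by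
          gcongr
      _ = _ := by ring
  refine iSup_le fun M => iSup_le fun _ => iSup_le fun i => iSup_le fun hi => ?_
  refine sInf_le ⟨ENNReal.ofReal_pos.2 hC0, ?_⟩
  intro Z _ _ nrm hZ f hf
  obtain ⟨L, hL, hlip⟩ := exists_isLipConst_lip hf
  obtain ⟨F, hFf, hF⟩ := hZ.exists_extension hp0 hp1 hk hr hN hi
    (f := fun s => f ⟨i s, s, rfl⟩) (L := L) fun s t => hL _ _
  have hF' : IsLipConst nrm F (C.toNNReal * L) := fun x y => by
    rw [NNReal.coe_mul, Real.coe_toNNReal _ hC0.le, mul_assoc]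
    exact (hF x y).trans (mul_le_mul_of_nonneg_right hrC (by positivity))
  refine ⟨F, ?_, ⟨_, hF'⟩, ?_⟩
  · rintro ⟨_, s, rfl⟩
    exact hFf s
  · refine (lip_le_of_isLipConst hF').trans_eq ?_
    rw [hlip, ENNReal.coe_mul]
    rfl
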